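/- Let $q\in\mathbb{C}$ with $0<|q|<1$, and write $(a;q)_\infty=\prod_{i=0}^\infty(1-aq^i)$. Define $p_k(y,z)$ for $k\in\mathbb{Z}$ and $y,z\in\mathbb{C}$ by $$\sum_{n=0}^\infty p_n(y,z)t^n=\frac{(-(1-q)t;q)_\infty}{((1-q)yt;q)_\infty\,((1-q)zt;q)_\infty}\quad(\text{for } t \text{ near } 0),\qquad p_k(y,z)=0\ \text{ for } k<0 .$$ For $N\in\mathbb{Z}$ let $$\phi_N(y,z)=\det\bigl(p_{N-2i+j}(y,z)\bigr)_{0\le i,j\le N-1}=\begin{vmatrix}p_N&p_{N+1}&\cdots&p_{2N-1}\\ p_{N-2}&p_{N-1}&\cdots&p_{2N-3}\\ \vdots&&\ddots&\vdots\\ p_{-N+2}&p_{-N+3}&\cdots&p_1\end{vmatrix}\quad\text{if } N>0,$$ $\phi_0(y,z)=1$, and $\phi_N(y,z)=(-1)^{N(N+1)/2}\phi_{-N-1}(y,z)$ if $N<0$. Then for every $N\in\mathbb{Z}$ and all $y,z\in\mathbb{C}$ the following four bilinear difference equations hold: $$\phi_{N+1}(y,z)\,\phi_N(y/q,z)+q^{N+1}z\,\phi_{N+1}(y/q,z)\,\phi_N(y,z)=(1+z)\,\phi_{N+1}(y,qz)\,\phi_N(y/q,z/q),$$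 $$q^{-N-1}z\,\phi_{N+1}(y,z)\,\phi_N(y/q,z)+\phi_{N+1}(y/q,z)\,\phi_N(y,z)=(1+z)\,\phi_{N+1}(y/q,z/q)\,\phi_N(y,qz),$$ $$z\,\phi_{N+1}(y/q,z/q)\,\phi_N(y,z)+y\,\phi_{N+1}(y,z)\,\phi_N(y/q,z/q)=(y+z)\,\phi_{N+1}(y,z/q)\,\phi_N(y/q,z),$$ $$y\,\phi_{N+1}(y/q,z/q)\,\phi_N(y,z)+z\,\phi_{N+1}(y,z)\,\phi_N(y/q,z/q)=(y+z)\,\phi_{N+1}(y/q,z)\,\phi_N(y,z/q).$$ -/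

import Mathlib

open scoped Topology

noncomputable section

namespace QP3

/-- The infinite `q`-shifted factorial `(a; q)_∞ = ∏_{i ≥ 0} (1 - a q^i)`. -/
def qPoch (a q : ℂ) : ℂ := ∏' i : ℕ, (1 - a * q ^ i)

/-- The generating function
`t ↦ (-(1-q)t; q)_∞ / (((1-q)yt; q)_∞ ((1-q)zt; q)_∞)`. -/
def genFun (q y z t : ℂ) : ℂ :=
  qPoch (-((1 - q) * t)) q / (qPoch ((1 - q) * y * t) q * qPoch ((1 - q) * z * t) q)

/-- `p_k(y, z)`: the coefficient of `t ^ k` in the Taylor expansion at `t = 0` of the generating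
function for `k ≥ 0`, and `0` for `k < 0`. -/
def p (q : ℂ) (k : ℤ) (y z : ℂ) : ℂ :=
  if k < 0 then 0
  else iteratedDeriv k.toNat (fun t => genFun q y z t) 0 / (k.toNat.factorial : ℂ)

/-- The `n × n` Jacobi–Trudi type determinant with rows
`(p_n, p_{n+1}, …, p_{2n-1})`, `(p_{n-2}, p_{n-1}, …, p_{2n-3})`, …, `(p_{-n+2}, …, p_1)`.
It equals `1` for `n = 0`. -/
def jacobiTrudi (q : ℂ) (n : ℕ) (y z : ℂ) : ℂ :=
  (Matrix.of fun i j : Fin n => p q ((n : ℤ) - 2 * (i : ℤ) + (j : ℤ)) y z).det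

/-- The function `φ_N(y, z)` for `N ∈ ℤ`. -/
def phi (q : ℂ) (N : ℤ) (y z : ℂ) : ℂ :=
  if 0 < N then jacobiTrudi q N.toNat y z
  else if N = 0 then 1
  else (-1) ^ (N * (N + 1) / 2) * jacobiTrudi q (-N - 1).toNat y z

/-- For negative `N` one has `φ_N = (-1)^{N(N+1)/2} φ_{-N-1}`. -/
theorem phi_neg (q : ℂ) {N : ℤ} (hN : N < 0) (y z : ℂ) :
    phi q N y z = (-1) ^ (N * (N + 1) / 2) * phi q (-N - 1) y z := by
  have h1 : ¬ 0 < N := by omega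
  have h2 : N ≠ 0 := by omega
  rcases (show -N - 1 = 0 ∨ 0 < -N - 1 by omega) with h | h
  · obtain rfl : N = -1 := by omega
    simp [phi, jacobiTrudi]
  · unfold phi
    rw [if_neg h1, if_neg h2, if_pos h]

theorem summable_aux (a : ℂ) {q : ℂ} (hq : ‖q‖ < 1) : Summable fun i : ℕ => ‖-(a * q ^ i)‖ := by
  simpa [norm_mul, norm_pow] using
    (summable_geometric_of_lt_one (norm_nonneg q) hq).mul_left ‖a‖

/-- The product defining `(a; q)_∞` converges for `|q| < 1`. -/
theorem multipliable_qPoch (a : ℂ) {q : ℂ} (hq : ‖q‖ < 1) :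
    Multipliable fun i : ℕ => 1 - a * q ^ i := by
  simpa [sub_eq_add_neg] using multipliable_one_add_of_summable (summable_aux a hq)

/-- `(a; q)_∞` is an entire function of `a` for `|q| < 1`. -/
theorem differentiable_qPoch {q : ℂ} (hq : ‖q‖ < 1) : Differentiable ℂ fun a => qPoch a q := by
  rw [← differentiableOn_univ]
  have h : HasProdLocallyUniformlyOn (fun (i : ℕ) (a : ℂ) => 1 - a * q ^ i)
      (fun a => ∏' i : ℕ, (1 - a * q ^ i)) Set.univ := by
    simp_rw [sub_eq_add_neg]
    apply hasProdLocallyUniformlyOn_of_forall_compact isOpen_univ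
    intro K _ hcK
    obtain ⟨C, hC⟩ := hcK.isBounded.exists_norm_le
    refine ((summable_geometric_of_lt_one (norm_nonneg q) hq).mul_left C).hasProdUniformlyOn_nat_one_add
      hcK (.of_forall fun n x hx => ?_) (fun _ => by fun_prop)
    simpa using mul_le_mul_of_nonneg_right (hC x hx) (pow_nonneg (norm_nonneg q) n)
  exact h.differentiableOn (.of_forall fun _ => by
    simpa [Finset.prod_fn] using DifferentiableOn.finsetProd (fun _ _ => by fun_prop)) isOpen_univ

/-- The numbers `p_n(y, z)` are indeed the coefficients of the generating function:
`∑ p_n(y, z) t^n` converges to it for all `t` near `0`. -/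
theorem hasSum_p {q : ℂ} (hq : ‖q‖ < 1) (y z : ℂ) :
    ∀ᶠ t in 𝓝 (0 : ℂ), HasSum (fun n : ℕ => p q n y z * t ^ n) (genFun q y z t) := by
  have hd := differentiable_qPoch hq
  have hden : Differentiable ℂ
      fun t : ℂ => qPoch ((1 - q) * y * t) q * qPoch ((1 - q) * z * t) q :=
    (hd.comp (f := fun t : ℂ => (1 - q) * y * t) (by fun_prop)).mul
      (hd.comp (f := fun t : ℂ => (1 - q) * z * t) (by fun_prop))
  have hnum : Differentiable ℂ fun t : ℂ => qPoch (-((1 - q) * t)) q :=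
    hd.comp (f := fun t : ℂ => -((1 - q) * t)) (by fun_prop)
  have h0 : qPoch ((1 - q) * y * 0) q * qPoch ((1 - q) * z * 0) q ≠ 0 := by simp [qPoch]
  have han : AnalyticAt ℂ (fun t => genFun q y z t) 0 :=
    (hnum.analyticAt 0).div (hden.analyticAt 0) h0
  obtain ⟨r, hr⟩ := han.hasFPowerSeriesAt
  filter_upwards [Metric.eball_mem_nhds (0 : ℂ) hr.r_pos] with t ht
  have := hr.hasSum ht
  simp only [zero_add, FormalMultilinearSeries.ofScalars_apply_eq, smul_eq_mul] at this
  have hn : ∀ n : ℕ, ¬ ((n : ℤ) < 0) := fun n => by omega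
  simpa only [p, hn, if_false, Int.toNat_natCast] using this

end QP3

end

/-! Encode `p_n` by its generating function; `subShift a` multiplies it by `1 - a t`. Replacing `y`
or `z` by its `q`-multiple, or comparing `(y, z; t)` with `(y/q, z/q; q t)`, costs exactly one such
linear factor. Two facts about staircase determinants then suffice. A three-term Plücker relation
(`staircaseDet_plucker`) links the determinants of `h` with those after multiplication by `1 - a t`,
`1 - c t` or both. Multiplication by the even factor `1 - b² t²` changes nothing
(`staircaseDet_even`), so `1 + b t` can stand for division by `1 - b t`. Suitable choices of `h`,
`a`, `c` give all four equations for `N ≥ 0`. The reflection `N ↦ -N - 1` exchanges the equations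
within each pair, which settles `N < 0`. -/

namespace QP3

/-! ### Staircase determinants: Plücker relation, even factors, scaling. -/

section Determinants

variable {R : Type*} [CommRing R]

/-- The coefficient sequence of `(1 - a t) ∑ h_n t^n`. -/
def subShift (a : R) (h : ℤ → R) : ℤ → R := fun n => h n - a * h (n - 1)

/-- The Jacobi–Trudi determinant of the staircase partition `(n, n - 1, …, 1)`. -/
def staircaseDet (h : ℤ → R) (n : ℕ) : R :=
  (Matrix.of fun i j : Fin n => h ((n : ℤ) - 2 * (i : ℤ) + (j : ℤ))).det

theorem subShift_comm (a b : R) (h : ℤ → R) :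
    subShift a (subShift b h) = subShift b (subShift a h) := by
  funext n
  simp only [subShift]
  ring

theorem subShift_of_neg (a : R) {h : ℤ → R} (hh : ∀ n < 0, h n = 0) :
    ∀ n < 0, subShift a h n = 0 := by
  intro n hn
  simp [subShift, hh n hn, hh (n - 1) (by omega)]

/-- The determinant with first two rows `x`, `y` and remaining rows `X`. -/
def detTwoRows {n : ℕ} (X : Fin n → Fin (n + 2) → R) (x y : Fin (n + 2) → R) : R :=
  (Matrix.of (Fin.cons x (Fin.cons y X : Fin (n + 1) → Fin (n + 2) → R) :
    Fin (n + 2) → Fin (n + 2) → R)).det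

theorem detTwoRows_swap {n : ℕ} (X : Fin n → Fin (n + 2) → R) (x y : Fin (n + 2) → R) :
    detTwoRows X y x = -detTwoRows X x y := by
  have h := (Matrix.detRowAlternating (R := R) (n := Fin (n + 2))).map_swap
    (Fin.cons x (Fin.cons y X : Fin (n + 1) → Fin (n + 2) → R))
    (i := 0) (j := Fin.succ 0) (Fin.succ_ne_zero 0).symm
  refine Eq.trans (congrArg Matrix.det ?_) h
  ext i j
  rw [Function.comp_apply]
  refine Fin.cases ?_ (fun i => Fin.cases ?_ (fun i => ?_) i) i
  · rw [Equiv.swap_apply_left]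
    rfl
  · rw [Equiv.swap_apply_right]
    rfl
  · rw [Equiv.swap_apply_of_ne_of_ne (Fin.succ_ne_zero _)
      (fun h => Fin.succ_ne_zero _ (Fin.succ_injective _ h))]
    rfl

theorem detTwoRows_eq_zero {n : ℕ} (X : Fin n → Fin (n + 2) → R) (i : Fin n)
    (y : Fin (n + 2) → R) : detTwoRows X (X i) y = 0 :=
  Matrix.det_zero_of_row_eq (i := 0) (j := i.succ.succ) (Fin.succ_ne_zero _).symm rfl

/-- `detTwoRows` as a linear map in its first row. -/
def detTwoRowsLeft {n : ℕ} (X : Fin n → Fin (n + 2) → R) (y : Fin (n + 2) → R) :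
    (Fin (n + 2) → R) →ₗ[R] R where
  toFun x := detTwoRows X x y
  map_add' x x' := (Matrix.detRowAlternating (R := R) (n := Fin (n + 2))).toMultilinearMap.cons_add
    (M := fun _ => Fin (n + 2) → R) (Fin.cons y X) x x'
  map_smul' c x := (Matrix.detRowAlternating (R := R) (n := Fin (n + 2))).toMultilinearMap.cons_smul
    (M := fun _ => Fin (n + 2) → R) (Fin.cons y X) c x

theorem detTwoRowsLeft_apply {n : ℕ} (X : Fin n → Fin (n + 2) → R) (x y : Fin (n + 2) → R) :
    detTwoRowsLeft X y x = detTwoRows X x y := rfl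

/-- The three-term Plücker relation. -/
theorem detTwoRows_plucker {n : ℕ} (X : Fin n → Fin (n + 2) → R) (a b c d : Fin (n + 2) → R) :
    detTwoRows X a b * detTwoRows X c d =
      detTwoRows X c b * detTwoRows X a d + detTwoRows X a c * detTwoRows X b d := by
  set M : Matrix (Fin (n + 2)) (Fin (n + 2)) R :=
    Matrix.of (Fin.cons a (Fin.cons b X : Fin (n + 1) → Fin (n + 2) → R)) with hM
  -- Cramer's rule expands `det M • c` in the rows of `M`. Applying `detTwoRows X · d` kills every
  -- row of `X`, and two terms survive.
  have h := Matrix.mulVec_cramer M.transpose c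
  have hv : M.transpose.mulVec (M.transpose.cramer c) = ∑ i, M.transpose.cramer c i • M i := by
    ext j
    simp [Matrix.mulVec, dotProduct, mul_comm]
  rw [hv, Matrix.det_transpose] at h
  have h2 := congrArg (detTwoRowsLeft X d) h
  rw [map_sum, Fin.sum_univ_succ, Fin.sum_univ_succ] at h2
  simp only [map_smul, detTwoRowsLeft_apply, smul_eq_mul] at h2
  have h0 : M.transpose.cramer c 0 = detTwoRows X c b := by
    rw [Matrix.cramer_transpose_apply]
    refine congrArg Matrix.det (funext fun i => ?_)
    refine Fin.cases ?_ (fun i => ?_) i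
    · exact Matrix.updateRow_self
    · exact Matrix.updateRow_ne (Fin.succ_ne_zero _)
  have h1 : M.transpose.cramer c (Fin.succ 0) = detTwoRows X a c := by
    rw [Matrix.cramer_transpose_apply]
    refine congrArg Matrix.det (funext fun i => ?_)
    refine Fin.cases ?_ (fun i => Fin.cases ?_ (fun i => ?_) i) i
    · exact Matrix.updateRow_ne (Fin.succ_ne_zero _).symm
    · exact Matrix.updateRow_self
    · exact Matrix.updateRow_ne (fun h => Fin.succ_ne_zero _ (Fin.succ_injective _ h))
  have hz : ∀ i : Fin n, M i.succ.succ = X i := fun i => rfl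
  have hM0 : M 0 = a := rfl
  have hM1 : M (Fin.succ 0) = b := rfl
  have hd : M.det = detTwoRows X a b := rfl
  simp only [hz, detTwoRows_eq_zero, mul_zero, Finset.sum_const_zero, add_zero, hM0, hM1,
    h0, h1, hd] at h2
  exact h2.symm

theorem det_cons_single {n : ℕ} (X : Fin n → Fin (n + 1) → R) :
    (Matrix.of (Fin.cons (Pi.single 0 1) X : Fin (n + 1) → Fin (n + 1) → R)).det =
      (Matrix.of fun i j => X i j.succ).det := by
  rw [Matrix.det_succ_row_zero, Finset.sum_eq_single 0]
  · simp
    rfl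
  · intro j _ hj
    simp [hj]
  · simp

/-- Subtracting `a` times the preceding column from each column turns the row of powers into `(1, 0,
…, 0)`. -/
theorem det_cons_pow {n : ℕ} (a : R) (X : Fin n → Fin (n + 1) → R) :
    (Matrix.of (Fin.cons (fun s => a ^ (s : ℕ)) X : Fin (n + 1) → Fin (n + 1) → R)).det =
      (Matrix.of fun i j => X i j.succ - a * X i j.castSucc).det := by
  have h := det_cons_single (fun i => Fin.cons (X i 0) (fun j => X i j.succ - a * X i j.castSucc))
  simp only [Fin.cons_succ] at h
  rw [← h]
  apply Matrix.det_eq_of_forall_col_eq_smul_add_pred (fun _ => a)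
  · intro i
    refine Fin.cases ?_ (fun i => ?_) i <;> simp
  · intro i j
    refine Fin.cases ?_ (fun i => ?_) i
    · simp [pow_succ']
    · simp

/-- Plücker relation for the four rows `(1, 0, …, 0)`, `(a^s)`, `(c^s)`, `r` above the common rows
`X`. Including `r` gives size `n + 1`; omitting it gives size `n`. -/
theorem staircaseDet_plucker (a c : R) (h : ℤ → R) (n : ℕ) :
    a * staircaseDet (subShift c h) (n + 1) * staircaseDet (subShift a h) n
        - c * staircaseDet (subShift a h) (n + 1) * staircaseDet (subShift c h) n
      = (a - c) * staircaseDet h (n + 1) * staircaseDet (subShift a (subShift c h)) n := by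
  set X : Fin n → Fin (n + 2) → R := fun i s => h ((n : ℤ) - 2 * ((i : ℤ) + 1) + s) with hX
  set r : Fin (n + 2) → R := fun s => h ((n : ℤ) + s) with hr
  set e : Fin (n + 2) → R := Pi.single 0 1 with he
  have hcons : ∀ (i : Fin (n + 1)) (s : Fin (n + 2)),
      (Fin.cons r X : Fin (n + 1) → Fin (n + 2) → R) i s = h ((n : ℤ) - 2 * (i : ℤ) + s) := by
    intro i s
    refine Fin.cases ?_ (fun i => ?_) i <;> simp [hr, hX]
  have h1 : detTwoRows X e r = staircaseDet h (n + 1) := by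
    unfold detTwoRows
    rw [he, det_cons_single]
    unfold staircaseDet
    congr 1
    ext i j
    simp only [Matrix.of_apply, hcons]
    congr 1
    push_cast [Fin.val_succ]
    ring
  have h2 : ∀ b : R, detTwoRows X (fun s => b ^ (s : ℕ)) r = staircaseDet (subShift b h) (n + 1) := by
    intro b
    unfold detTwoRows
    rw [det_cons_pow]
    unfold staircaseDet
    congr 1
    ext i j
    simp only [Matrix.of_apply, hcons, subShift]
    congr 2
    · push_cast [Fin.val_succ]
      ring
    · congr 1
      push_cast [Fin.val_castSucc]
      ring
  have h3 : ∀ b : R, detTwoRows X e (fun s => b ^ (s : ℕ)) = b * staircaseDet (subShift b h) n := by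
    intro b
    unfold detTwoRows
    rw [he, det_cons_single]
    -- Without its column `0`, the row of powers is `b` times a shorter row of powers: this is the
    -- factor `b`.
    have : (Matrix.of fun (i j : Fin (n + 1)) =>
        (Fin.cons (fun s : Fin (n + 2) => b ^ (s : ℕ)) X : Fin (n + 1) → Fin (n + 2) → R) i j.succ)
        = (Matrix.of (Fin.cons (fun s => b ^ (s : ℕ)) fun i j => X i j.succ :
          Fin (n + 1) → Fin (n + 1) → R)).updateRow 0 (b • fun s : Fin (n + 1) => b ^ (s : ℕ)) := by
      ext i j
      refine Fin.cases ?_ (fun i => ?_) i <;> simp [Matrix.updateRow_apply, pow_succ']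
    rw [this, Matrix.det_updateRow_smul]
    congr 1
    have : (Matrix.of (Fin.cons (fun s => b ^ (s : ℕ)) fun i j => X i j.succ :
          Fin (n + 1) → Fin (n + 1) → R)).updateRow 0 (fun s => b ^ (s : ℕ))
        = (Matrix.of (Fin.cons (fun s => b ^ (s : ℕ)) fun i j => X i j.succ :
          Fin (n + 1) → Fin (n + 1) → R)) := by
      ext i j
      refine Fin.cases ?_ (fun i => ?_) i <;> simp [Matrix.updateRow_apply]
    rw [this, det_cons_pow]
    unfold staircaseDet
    congr 1
    ext i j
    simp only [Matrix.of_apply, hX, subShift]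
    congr 2
    · push_cast [Fin.val_succ]
      ring
    · congr 1
      push_cast [Fin.val_castSucc, Fin.val_succ]
      ring
  have h4 : detTwoRows X (fun s => a ^ (s : ℕ)) (fun s => c ^ (s : ℕ))
      = (c - a) * staircaseDet (subShift a (subShift c h)) n := by
    unfold detTwoRows
    rw [det_cons_pow]
    set Y : Fin n → Fin (n + 1) → R := fun i j => X i j.succ - a * X i j.castSucc with hY
    -- The column operations send `c^s` to `c^(s+1) - a c^s`, hence the factor `c - a`.
    have : (Matrix.of fun (i j : Fin (n + 1)) =>
        (Fin.cons (fun s : Fin (n + 2) => c ^ (s : ℕ)) X : Fin (n + 1) → Fin (n + 2) → R) i j.succ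
        - a * (Fin.cons (fun s : Fin (n + 2) => c ^ (s : ℕ)) X :
          Fin (n + 1) → Fin (n + 2) → R) i j.castSucc)
        = (Matrix.of (Fin.cons (fun s => c ^ (s : ℕ)) Y :
          Fin (n + 1) → Fin (n + 1) → R)).updateRow 0 ((c - a) • fun s : Fin (n + 1) => c ^ (s : ℕ)) := by
      ext i j
      refine Fin.cases ?_ (fun i => ?_) i
      · simp [Matrix.updateRow_apply, pow_succ']
        ring
      · simp [Matrix.updateRow_apply, hY]
    rw [this, Matrix.det_updateRow_smul]
    congr 1
    have : (Matrix.of (Fin.cons (fun s => c ^ (s : ℕ)) Y :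
          Fin (n + 1) → Fin (n + 1) → R)).updateRow 0 (fun s => c ^ (s : ℕ))
        = (Matrix.of (Fin.cons (fun s => c ^ (s : ℕ)) Y :
          Fin (n + 1) → Fin (n + 1) → R)) := by
      ext i j
      refine Fin.cases ?_ (fun i => ?_) i <;> simp [Matrix.updateRow_apply]
    rw [this, det_cons_pow, subShift_comm]
    unfold staircaseDet
    congr 1
    ext i j
    simp only [Matrix.of_apply, hY, hX, subShift]
    push_cast [Fin.val_castSucc, Fin.val_succ]
    ring_nf
  have hp := detTwoRows_plucker X e (fun s => a ^ (s : ℕ)) (fun s => c ^ (s : ℕ)) r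
  rw [h2, h3, h1, h2, h3, detTwoRows_swap, h4] at hp
  linear_combination hp

/-- Consecutive rows differ by an index shift of 2, so multiplying by `1 - b² t²` subtracts `b²`
times the next row. Reversing the order makes the next row the preceding one. -/
theorem staircaseDet_even (b : R) {h : ℤ → R} (hh : ∀ n < 0, h n = 0) (n : ℕ) :
    staircaseDet (subShift b (subShift (-b) h)) n = staircaseDet h n := by
  rcases n with _ | n
  · simp [staircaseDet]
  unfold staircaseDet
  rw [← Matrix.det_submatrix_equiv_self Fin.revPerm,
    ← Matrix.det_submatrix_equiv_self Fin.revPerm (Matrix.of fun i j : Fin (n + 1) => h _)]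
  symm
  apply Matrix.det_eq_of_forall_row_eq_smul_add_pred (fun _ => b ^ 2)
  · intro j
    simp only [Matrix.submatrix_apply, Matrix.of_apply, subShift, Fin.revPerm_apply, Fin.val_rev]
    have hj := j.2
    -- The original bottom row has no successor, but its entries shifted by 2 have negative index.
    rw [hh (_ - 1 - 1)]
    · ring
    · simp
      omega
  · intro i j
    have hi := i.2
    have hj := j.2
    simp only [Matrix.submatrix_apply, Matrix.of_apply, subShift, Fin.revPerm_apply, Fin.val_rev,
      Fin.val_succ, Fin.val_castSucc]
    have e1 : ((n + 1 : ℕ) : ℤ) - 2 * ((n + 1 - (i + 1) : ℕ) : ℤ) + ((n + 1 - (j + 1) : ℕ) : ℤ)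
      = ((n + 1 : ℕ) : ℤ) - 2 * ((n + 1 - (i + 1 + 1) : ℕ) : ℤ) + ((n + 1 - (j + 1) : ℕ) : ℤ) - 1 - 1 := by
      omega
    rw [e1]
    ring

end Determinants

/-- The exponent `n - 2i + j` splits into row and column parts, which sum to `n(n+1)/2`. -/
theorem staircaseDet_scale {K : Type*} [Field K] {q : K} (hq : q ≠ 0) (h : ℤ → K) (n : ℕ) :
    staircaseDet (fun k => q ^ k * h k) n = q ^ ((n : ℤ) * (n + 1) / 2) * staircaseDet h n := by
  unfold staircaseDet
  have : (Matrix.of fun i j : Fin n => q ^ ((n : ℤ) - 2 * (i : ℤ) + (j : ℤ)) *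
      h ((n : ℤ) - 2 * (i : ℤ) + (j : ℤ))) = Matrix.of fun i j : Fin n =>
        q ^ ((n : ℤ) - 2 * (i : ℤ)) * (Matrix.of fun i j : Fin n => q ^ (j : ℤ) *
          (Matrix.of fun i j : Fin n => h ((n : ℤ) - 2 * (i : ℤ) + (j : ℤ))) i j) i j := by
    ext i j
    simp [zpow_add₀ hq, mul_assoc]
  rw [this, Matrix.det_mul_column, Matrix.det_mul_row, ← mul_assoc]
  congr 1
  have hs : ∀ m : ℕ, 2 * ∑ i ∈ Finset.range m, (i : ℤ) = m * (m - 1) := by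
    intro m
    induction m with
    | zero => simp
    | succ m ih => rw [Finset.sum_range_succ, mul_add, ih]; push_cast; ring
  have hprod : ∀ f : Fin n → ℤ, ∏ i, q ^ f i = q ^ ∑ i, f i := by
    intro f
    induction (Finset.univ : Finset (Fin n)) using Finset.induction_on with
    | empty => simp
    | insert a s ha ih => rw [Finset.prod_insert ha, Finset.sum_insert ha, ih, zpow_add₀ hq]
  rw [hprod, hprod, ← zpow_add₀ hq]
  congr 1
  rw [Finset.sum_sub_distrib, ← Finset.mul_sum, Fin.sum_univ_eq_sum_range (fun i => (i : ℤ)), hs]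
  have := hs n
  simp only [Finset.sum_const, Finset.card_univ, Fintype.card_fin, nsmul_eq_mul]
  apply (Int.ediv_eq_of_eq_mul_right (by norm_num) _).symm
  linear_combination -this

/-! ### Shifts of the generating function. -/

/-- The Taylor coefficients `p_n(y, z)` as a sequence indexed by `ℤ`. -/
noncomputable def pSeq (q y z : ℂ) : ℤ → ℂ := fun n => p q n y z

/-- The Taylor coefficients of the generating function at `q t` with parameters `y / q`, `z / q`. -/
noncomputable def pSeqScaled (q y z : ℂ) : ℤ → ℂ := fun n => q ^ n * pSeq q (y / q) (z / q) n

theorem pSeq_of_neg (q y z : ℂ) : ∀ n < 0, pSeq q y z n = 0 := by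
  intro n hn
  simp [pSeq, p, hn]

theorem pSeqScaled_of_neg (q y z : ℂ) : ∀ n < 0, pSeqScaled q y z n = 0 := by
  intro n hn
  simp [pSeqScaled, pSeq_of_neg _ _ _ n hn]

theorem qPoch_eq_mul {q : ℂ} (hq : ‖q‖ < 1) (a : ℂ) :
    qPoch a q = (1 - a) * qPoch (a * q) q := by
  unfold qPoch
  rw [tprod_eq_zero_mul' (f := fun i : ℕ => 1 - a * q ^ i)]
  · simp [pow_succ', mul_assoc]
  · simpa [pow_succ', mul_assoc] using multipliable_qPoch (a * q) hq

theorem hasSum_subShift {h : ℤ → ℂ} (hh : ∀ n < 0, h n = 0) (b : ℂ) {t s : ℂ}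
    (hs : HasSum (fun n : ℕ => h n * t ^ n) s) :
    HasSum (fun n : ℕ => subShift b h n * t ^ n) ((1 - b * t) * s) := by
  have h1 : HasSum (fun n : ℕ => h ((n : ℤ) - 1) * t ^ n) (t * s) := by
    rw [← hasSum_nat_add_iff' 1]
    simpa [hh, pow_succ', mul_left_comm] using hs.mul_left t
  have e1 : (fun n : ℕ => subShift b h n * t ^ n) =
      fun n : ℕ => h n * t ^ n - b * (h ((n : ℤ) - 1) * t ^ n) := by
    funext n
    simp only [subShift]
    ring
  have e2 : (1 - b * t) * s = s - b * (t * s) := by ring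
  rw [e1, e2]
  exact hs.sub (h1.mul_left b)

theorem eq_of_hasSum_eventually {c d : ℤ → ℂ} (hc : ∀ n < 0, c n = 0) (hd : ∀ n < 0, d n = 0)
    {f : ℂ → ℂ} (hcf : ∀ᶠ t in 𝓝 (0 : ℂ), HasSum (fun n : ℕ => c n * t ^ n) (f t))
    (hdf : ∀ᶠ t in 𝓝 (0 : ℂ), HasSum (fun n : ℕ => d n * t ^ n) (f t)) : c = d := by
  have key : ∀ e : ℤ → ℂ, (∀ᶠ t in 𝓝 (0 : ℂ), HasSum (fun n : ℕ => e n * t ^ n) (f t)) →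
      HasFPowerSeriesAt f (FormalMultilinearSeries.ofScalars ℂ fun n : ℕ => e n) 0 := by
    intro e he
    rw [hasFPowerSeriesAt_iff]
    filter_upwards [he] with t ht
    simpa [FormalMultilinearSeries.coeff_ofScalars, mul_comm] using ht
  have h := (key c hcf).eq_formalMultilinearSeries (key d hdf)
  funext n
  rcases lt_or_ge n 0 with hn | hn
  · rw [hc n hn, hd n hn]
  · lift n to ℕ using hn
    simpa [FormalMultilinearSeries.coeff_ofScalars] using
      congrArg (fun P : FormalMultilinearSeries ℂ ℂ ℂ => P.coeff n) h

theorem eventually_one_sub_mul_ne_zero (b : ℂ) : ∀ᶠ t in 𝓝 (0 : ℂ), 1 - b * t ≠ 0 := by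
  have : ContinuousAt (fun t : ℂ => 1 - b * t) 0 := by fun_prop
  exact this.eventually_ne (by simp)

theorem pSeq_comm (q y z : ℂ) : pSeq q y z = pSeq q z y := by
  funext n
  have : (fun t => genFun q y z t) = fun t => genFun q z y t := by
    funext t
    simp only [genFun, mul_comm]
  simp only [pSeq, p, this]

theorem pSeq_eq_subShift_left {q : ℂ} (hq0 : q ≠ 0) (hq : ‖q‖ < 1) (y z : ℂ) :
    pSeq q y z = subShift ((1 - q) * (y / q)) (pSeq q (y / q) z) := by
  refine eq_of_hasSum_eventually (pSeq_of_neg _ _ _) (subShift_of_neg _ (pSeq_of_neg _ _ _))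
    (hasSum_p hq y z) ?_
  filter_upwards [hasSum_p hq (y / q) z, eventually_one_sub_mul_ne_zero ((1 - q) * (y / q))]
    with t ht hne
  have := hasSum_subShift (pSeq_of_neg q (y / q) z) ((1 - q) * (y / q)) ht
  convert this using 1
  have e : (1 - q) * (y / q) * t * q = (1 - q) * y * t := by field_simp
  rw [genFun, genFun, qPoch_eq_mul hq ((1 - q) * (y / q) * t), e, ← mul_div_assoc,
    mul_assoc (1 - (1 - q) * (y / q) * t), mul_div_mul_left _ _ hne]

theorem pSeq_eq_subShift_right {q : ℂ} (hq0 : q ≠ 0) (hq : ‖q‖ < 1) (y z : ℂ) :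
    pSeq q y z = subShift ((1 - q) * (z / q)) (pSeq q y (z / q)) := by
  rw [pSeq_comm q y z, pSeq_comm q y, pSeq_eq_subShift_left hq0 hq]

theorem pSeq_mul_right {q : ℂ} (hq0 : q ≠ 0) (hq : ‖q‖ < 1) (y z : ℂ) :
    pSeq q y (q * z) = subShift ((1 - q) * z) (pSeq q y z) := by
  rw [pSeq_eq_subShift_right hq0 hq, mul_div_cancel_left₀ _ hq0]

theorem pSeq_eq_subShift_scaled {q : ℂ} (hq0 : q ≠ 0) (hq : ‖q‖ < 1) (y z : ℂ) :
    pSeq q y z = subShift (-(1 - q)) (pSeqScaled q y z) := by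
  refine eq_of_hasSum_eventually (pSeq_of_neg _ _ _) (subShift_of_neg _ (pSeqScaled_of_neg _ _ _))
    (hasSum_p hq y z) ?_
  have htend : Filter.Tendsto (fun t : ℂ => q * t) (𝓝 0) (𝓝 0) := by
    have : ContinuousAt (fun t : ℂ => q * t) 0 := by fun_prop
    simpa [ContinuousAt] using this
  filter_upwards [htend.eventually (hasSum_p hq (y / q) (z / q))] with t ht
  have ht' : HasSum (fun n : ℕ => pSeqScaled q y z n * t ^ n)
      (genFun q (y / q) (z / q) (q * t)) := by
    convert ht using 2 with n
    simp only [pSeqScaled, pSeq, mul_pow, zpow_natCast]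
    ring
  have := hasSum_subShift (pSeqScaled_of_neg q y z) (-(1 - q)) ht'
  convert this using 1
  have e1 : (1 - q) * (y / q) * (q * t) = (1 - q) * y * t := by field_simp
  have e2 : (1 - q) * (z / q) * (q * t) = (1 - q) * z * t := by field_simp
  have e3 : -((1 - q) * t) * q = -((1 - q) * (q * t)) := by ring
  rw [genFun, genFun, qPoch_eq_mul hq (-((1 - q) * t)), e1, e2, e3, mul_div_assoc, neg_mul]

theorem pSeqScaled_mul_right {q : ℂ} (hq0 : q ≠ 0) (hq : ‖q‖ < 1) (y z : ℂ) :
    pSeqScaled q y (q * z) = subShift ((1 - q) * z) (pSeqScaled q y z) := by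
  funext n
  have h := congrFun (pSeq_mul_right hq0 hq (y / q) (z / q)) n
  have e : q * (z / q) = q * z / q := by ring
  rw [e] at h
  simp only [pSeqScaled, h, subShift]
  rw [zpow_sub_one₀ hq0]
  field_simp

/-! ### Extension to negative indices. -/

/-- Extension of a sequence `(u_n)_{n ≥ 0}` to `ℤ` by `u_N = (-1)^{N(N+1)/2} u_{-N-1}`. -/
noncomputable def signedExtension (u : ℕ → ℂ) (N : ℤ) : ℂ :=
  if 0 ≤ N then u N.toNat else (-1) ^ (N * (N + 1) / 2) * u (-N - 1).toNat

theorem phi_eq_signedExtension (q : ℂ) (N : ℤ) (y z : ℂ) :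
    phi q N y z = signedExtension (staircaseDet (pSeq q y z)) N := by
  have hJ : ∀ n : ℕ, jacobiTrudi q n y z = staircaseDet (pSeq q y z) n := fun n => rfl
  rcases lt_trichotomy N 0 with hN | rfl | hN
  · simp [phi, signedExtension, hJ, hN.not_ge, hN.not_gt, hN.ne]
  · simp [phi, signedExtension, staircaseDet]
  · simp [phi, signedExtension, hJ, hN, hN.le]

/-- `N(N+1)/2` is invariant under `N ↦ -N - 1`, so one scaling factor serves both signs. -/
theorem signedExtension_scaled {q : ℂ} (hq0 : q ≠ 0) (y z : ℂ) (N : ℤ) :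
    signedExtension (staircaseDet (pSeqScaled q y z)) N =
      q ^ (N * (N + 1) / 2) * phi q N (y / q) (z / q) := by
  have hs : ∀ n : ℕ, staircaseDet (pSeqScaled q y z) n =
      q ^ ((n : ℤ) * (n + 1) / 2) * staircaseDet (pSeq q (y / q) (z / q)) n :=
    staircaseDet_scale hq0 _
  rw [phi_eq_signedExtension]
  unfold signedExtension
  split_ifs with hN
  · rw [hs, Int.toNat_of_nonneg hN]
  · rw [hs, Int.toNat_of_nonneg (by omega)]
    have : (-N - 1) * (-N - 1 + 1) = N * (N + 1) := by ring
    rw [this]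
    ring

/-- A bilinear relation between signed extensions, which is exchanged with its mirror image under
`N ↦ -N - 1`. -/
theorem signedExtension_bilinear {a b : ℂ} {x o u v : ℕ → ℂ} (hx : x 0 = 1) (ho : o 0 = 1)
    (hu : u 0 = 1) (hv : v 0 = 1)
    (h₁ : ∀ n, a * x (n + 1) * o n + b * o (n + 1) * x n = (a + b) * u (n + 1) * v n)
    (h₂ : ∀ n, b * x (n + 1) * o n + a * o (n + 1) * x n = (a + b) * v (n + 1) * u n) (N : ℤ) :
    a * signedExtension x (N + 1) * signedExtension o N
        + b * signedExtension o (N + 1) * signedExtension x N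
      = (a + b) * signedExtension u (N + 1) * signedExtension v N := by
  rcases le_or_gt 0 N with hN | hN
  · lift N to ℕ using hN
    have h : ((N : ℤ) + 1).toNat = N + 1 := by omega
    simpa [signedExtension, show (0 : ℤ) ≤ (N : ℤ) + 1 by omega, h] using h₁ N
  · rcases (show N = -1 ∨ N + 1 < 0 by omega) with rfl | hN1
    -- At `N = -1` every factor is an initial value, so both sides equal `a + b`.
    · simp [signedExtension, hx, ho, hu, hv]
    · obtain ⟨n, rfl⟩ : ∃ n : ℕ, N = -(n : ℤ) - 2 := ⟨(-N - 2).toNat, by omega⟩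
      have e1 : (-(-(n : ℤ) - 2) - 1).toNat = n + 1 := by omega
      have e2 : (-(-(n : ℤ) - 2 + 1) - 1).toNat = n := by omega
      simp only [signedExtension, hN.not_ge, hN1.not_ge, if_false, e1, e2]
      linear_combination (-1) ^ ((-(n : ℤ) - 2) * (-(n : ℤ) - 2 + 1) / 2) *
        (-1) ^ ((-(n : ℤ) - 2 + 1) * (-(n : ℤ) - 2 + 1 + 1) / 2) * h₂ n

theorem staircaseDet_zero {R : Type*} [CommRing R] (h : ℤ → R) : staircaseDet h 0 = 1 := by
  simp [staircaseDet]

/-! ### The bilinear relations for natural indices. -/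

theorem staircaseDet_bilinear_scaled {q : ℂ} (hq0 : q ≠ 0) (hq : ‖q‖ < 1) (y z : ℂ) (n : ℕ) :
    1 * staircaseDet (pSeq q y z) (n + 1) * staircaseDet (pSeqScaled q y (q * z)) n
        + z * staircaseDet (pSeqScaled q y (q * z)) (n + 1) * staircaseDet (pSeq q y z) n
      = (1 + z) * staircaseDet (pSeq q y (q * z)) (n + 1) * staircaseDet (pSeqScaled q y z) n := by
  have hδ : 1 - q ≠ 0 := sub_ne_zero.2 (by rintro rfl; simp at hq)
  -- Both parameters are opposite to those of the shift lemmas, so each new factor completes an even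
  -- one, which drops out.
  have h := staircaseDet_plucker (1 - q) (-((1 - q) * z)) (pSeq q y (q * z)) n
  have e1 : ∀ m, staircaseDet (subShift (-((1 - q) * z)) (pSeq q y (q * z))) m
      = staircaseDet (pSeq q y z) m := fun m => by
    rw [pSeq_mul_right hq0 hq, subShift_comm, staircaseDet_even _ (pSeq_of_neg _ _ _)]
  have e2 : ∀ m, staircaseDet (subShift (1 - q) (pSeq q y (q * z))) m
      = staircaseDet (pSeqScaled q y (q * z)) m := fun m => by
    rw [pSeq_eq_subShift_scaled hq0 hq, staircaseDet_even _ (pSeqScaled_of_neg _ _ _)]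
  have e3 : staircaseDet (subShift (1 - q) (subShift (-((1 - q) * z)) (pSeq q y (q * z)))) n
      = staircaseDet (pSeqScaled q y z) n := by
    rw [pSeq_eq_subShift_scaled hq0 hq, pSeqScaled_mul_right hq0 hq,
      subShift_comm (-((1 - q) * z)),
      staircaseDet_even _ (subShift_of_neg _ (subShift_of_neg _ (pSeqScaled_of_neg _ _ _))),
      subShift_comm, staircaseDet_even _ (pSeqScaled_of_neg _ _ _)]
  rw [e1, e1, e2, e2, e3] at h
  apply mul_left_cancel₀ hδ
  linear_combination h

/-- Here the Plücker factors are the shifts themselves; no even factor arises. -/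
theorem staircaseDet_bilinear_scaled_dual {q : ℂ} (hq0 : q ≠ 0) (hq : ‖q‖ < 1) (y z : ℂ) (n : ℕ) :
    z * staircaseDet (pSeq q y z) (n + 1) * staircaseDet (pSeqScaled q y (q * z)) n
        + 1 * staircaseDet (pSeqScaled q y (q * z)) (n + 1) * staircaseDet (pSeq q y z) n
      = (1 + z) * staircaseDet (pSeqScaled q y z) (n + 1) * staircaseDet (pSeq q y (q * z)) n := by
  have hδ : 1 - q ≠ 0 := sub_ne_zero.2 (by rintro rfl; simp at hq)
  have h := staircaseDet_plucker (-(1 - q)) ((1 - q) * z) (pSeqScaled q y z) n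
  rw [← pSeqScaled_mul_right hq0 hq, ← pSeq_eq_subShift_scaled hq0 hq,
    ← pSeq_eq_subShift_scaled hq0 hq] at h
  apply mul_left_cancel₀ hδ
  linear_combination -h

/-- The `y`-factor is a genuine shift, while the `z`-factor completes an even one. Exchanging `y`
and `z` gives the mirror relation. -/
theorem staircaseDet_bilinear_div {q : ℂ} (hq0 : q ≠ 0) (hq : ‖q‖ < 1) (y z : ℂ) (n : ℕ) :
    z * staircaseDet (pSeq q y z) (n + 1) * staircaseDet (pSeq q (y / q) (z / q)) n
        + y * staircaseDet (pSeq q (y / q) (z / q)) (n + 1) * staircaseDet (pSeq q y z) n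
      = (z + y) * staircaseDet (pSeq q (y / q) z) (n + 1)
          * staircaseDet (pSeq q y (z / q)) n := by
  have hδ : (1 - q) / q ≠ 0 :=
    div_ne_zero (sub_ne_zero.2 (by rintro rfl; simp at hq)) hq0
  have h := staircaseDet_plucker ((1 - q) * (y / q)) (-((1 - q) * (z / q))) (pSeq q (y / q) z) n
  have e1 : ∀ m, staircaseDet (subShift (-((1 - q) * (z / q))) (pSeq q (y / q) z)) m
      = staircaseDet (pSeq q (y / q) (z / q)) m := fun m => by
    rw [pSeq_eq_subShift_right hq0 hq (y / q) z, subShift_comm,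
      staircaseDet_even _ (pSeq_of_neg _ _ _)]
  have e2 : staircaseDet (subShift ((1 - q) * (y / q))
      (subShift (-((1 - q) * (z / q))) (pSeq q (y / q) z))) n
      = staircaseDet (pSeq q y (z / q)) n := by
    rw [subShift_comm, ← pSeq_eq_subShift_left hq0 hq, pSeq_eq_subShift_right hq0 hq,
      subShift_comm, staircaseDet_even _ (pSeq_of_neg _ _ _)]
  rw [e1, e1, e2, ← pSeq_eq_subShift_left hq0 hq] at h
  apply mul_left_cancel₀ hδ
  linear_combination h

theorem zpow_triangular_succ {q : ℂ} (hq0 : q ≠ 0) (N : ℤ) :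
    q ^ ((N + 1) * (N + 1 + 1) / 2) = q ^ (N + 1) * q ^ (N * (N + 1) / 2) := by
  rw [← zpow_add₀ hq0]
  congr 1
  have : (N + 1) * (N + 1 + 1) = N * (N + 1) + (N + 1) * 2 := by ring
  rw [this, Int.add_mul_ediv_right _ _ (by norm_num), add_comm]

end QP3

theorem proposition3p2 (q : ℂ) (hq0 : q ≠ 0) (hq1 : ‖q‖ < 1) (N : ℤ) (y z : ℂ) :
    (QP3.phi q (N + 1) y z * QP3.phi q N (y / q) z
        + q ^ (N + 1) * z * QP3.phi q (N + 1) (y / q) z * QP3.phi q N y z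
      = (1 + z) * QP3.phi q (N + 1) y (q * z) * QP3.phi q N (y / q) (z / q)) ∧
    (q ^ (-N - 1) * z * QP3.phi q (N + 1) y z * QP3.phi q N (y / q) z
        + QP3.phi q (N + 1) (y / q) z * QP3.phi q N y z
      = (1 + z) * QP3.phi q (N + 1) (y / q) (z / q) * QP3.phi q N y (q * z)) ∧
    (z * QP3.phi q (N + 1) (y / q) (z / q) * QP3.phi q N y z
        + y * QP3.phi q (N + 1) y z * QP3.phi q N (y / q) (z / q)
      = (y + z) * QP3.phi q (N + 1) y (z / q) * QP3.phi q N (y / q) z) ∧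
    (y * QP3.phi q (N + 1) (y / q) (z / q) * QP3.phi q N y z
        + z * QP3.phi q (N + 1) y z * QP3.phi q N (y / q) (z / q)
      = (y + z) * QP3.phi q (N + 1) (y / q) z * QP3.phi q N y (z / q)) := by
  have hc : q ^ (N * (N + 1) / 2) ≠ 0 := zpow_ne_zero _ hq0
  have hz : q * z / q = z := mul_div_cancel_left₀ z hq0
  have hneg : q ^ (-N - 1) * q ^ (N + 1) = 1 := by
    rw [← zpow_add₀ hq0]
    simp
  refine ⟨?_, ?_, ?_, ?_⟩
  · have h := QP3.signedExtension_bilinear (QP3.staircaseDet_zero _) (QP3.staircaseDet_zero _)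
      (QP3.staircaseDet_zero _) (QP3.staircaseDet_zero _)
      (QP3.staircaseDet_bilinear_scaled hq0 hq1 y z)
      (QP3.staircaseDet_bilinear_scaled_dual hq0 hq1 y z) N
    simp only [QP3.signedExtension_scaled hq0, ← QP3.phi_eq_signedExtension, hz,
      QP3.zpow_triangular_succ hq0] at h
    apply mul_left_cancel₀ hc
    linear_combination h
  · have h := QP3.signedExtension_bilinear (QP3.staircaseDet_zero _) (QP3.staircaseDet_zero _)
      (QP3.staircaseDet_zero _) (QP3.staircaseDet_zero _)
      (fun n => (QP3.staircaseDet_bilinear_scaled_dual hq0 hq1 y z n).trans (by rw [add_comm z]))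
      (fun n => (QP3.staircaseDet_bilinear_scaled hq0 hq1 y z n).trans (by rw [add_comm z])) N
    simp only [QP3.signedExtension_scaled hq0, ← QP3.phi_eq_signedExtension, hz,
      QP3.zpow_triangular_succ hq0] at h
    apply mul_left_cancel₀ hc
    -- The relation carries `q^(N+1)` on the terms with a scaled factor at `N + 1`; multiplying by
    -- `q^(-N-1)` moves it to the remaining term.
    linear_combination q ^ (-N - 1) * h + q ^ (N * (N + 1) / 2) *
      ((1 + z) * QP3.phi q (N + 1) (y / q) (z / q) * QP3.phi q N y (q * z)
        - QP3.phi q (N + 1) (y / q) z * QP3.phi q N y z) * hneg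
  all_goals
    have hyz := QP3.staircaseDet_bilinear_div hq0 hq1 y z
    have hzy := QP3.staircaseDet_bilinear_div hq0 hq1 z y
    rw [QP3.pSeq_comm q z y, QP3.pSeq_comm q (z / q) (y / q), QP3.pSeq_comm q (z / q) y,
      QP3.pSeq_comm q z (y / q)] at hzy
  · have h := QP3.signedExtension_bilinear (QP3.staircaseDet_zero _) (QP3.staircaseDet_zero _)
      (QP3.staircaseDet_zero _) (QP3.staircaseDet_zero _) hzy
      (fun n => (hyz n).trans (by rw [add_comm z])) N
    simp only [← QP3.phi_eq_signedExtension] at h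
    linear_combination h
  · have h := QP3.signedExtension_bilinear (QP3.staircaseDet_zero _) (QP3.staircaseDet_zero _)
      (QP3.staircaseDet_zero _) (QP3.staircaseDet_zero _) hyz
      (fun n => (hzy n).trans (by rw [add_comm z])) N
    simp only [← QP3.phi_eq_signedExtension] at h
    linear_combination h
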